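/- Let $N\ge 1$, and for a smooth scalar field $f:\mathbb{R}^N\to\mathbb{R}$ put $$\|f\|_{\mathcal D}:=\Big(\int_{\mathbb{R}^N}f^2\,dx+\int_{\mathbb{R}^N}f^2|x|^2\,dx+\int_{\mathbb{R}^N}|\nabla f|^2\,dx\Big)^{1/2}\in[0,\infty].$$ Let $\mathbb{S}^{N-1}$ be the unit sphere of $\mathbb{R}^N$ and $\mathrm{d}\sigma$ its surface measure (the counting measure on $\{\pm1\}$ if $N=1$). Suppose that $f\in C^\infty(\mathbb{R}^N)$ satisfies $\|f\|_{\mathcal D}<\infty$, $$\int_{\mathbb{S}^{N-1}}f(r\sigma)\,\mathrm{d}\sigma=0\quad\text{for all } r>0,\qquad\text{and}\qquad \int_{\mathbb{S}^{N-1}}f(R\sigma)^2\,\mathrm{d}\sigma=o(R^{-N})\quad\text{as } R\to\infty.$$ Then $$\int_{\mathbb{R}^N}|\nabla f|^2\,dx\int_{\mathbb{R}^N}f^2|x|^2\,dx\ \ge\ \Big(\frac{N+2}{2}\Big)^2\Big(\int_{\mathbb{R}^N}f^2\,dx\Big)^2 .$$ Moreover, for all constants $B_0>0$ and $B_1,\dots,B_N\in\mathbb{R}$,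 the function $f(x)=\sum_{k=1}^N B_kx_k\,e^{-B_0|x|^2}$ satisfies all the above hypotheses, and equality holds for it. -/

import Mathlib

open MeasureTheory Filter Asymptotics
open scoped ENNReal ContDiff Gradient

noncomputable section

/-- Euclidean space `ℝ^N`. -/
abbrev RN (N : ℕ) : Type := EuclideanSpace ℝ (Fin N)

/-- The integral `∫_{S^{N-1}} g(σ) dσ` with respect to the surface measure of the unit sphere. -/
def sphereIntegral {N : ℕ} (g : RN N → ℝ) : ℝ :=
  ∫ σ : Metric.sphere (0 : RN N) 1, g σ ∂((volume : Measure (RN N)).toSphere)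

/-- `‖f‖_D = (∫ |f|² + ∫ |f|² |x|² + ∫ |∇f|²)^{1/2}`, as an element of `[0, ∞]`. -/
def normD {N : ℕ} (f : RN N → ℝ) : ℝ≥0∞ :=
  ((∫⁻ x, ‖f x‖ₑ ^ 2) + (∫⁻ x, ‖f x‖ₑ ^ 2 * ‖x‖ₑ ^ 2) + ∫⁻ x, ‖∇ f x‖ₑ ^ 2) ^ (1 / 2 : ℝ)

/-- Smooth scalar fields with finite `D`-norm, zero mean on every sphere centred at the origin,
and `∫_{S^{N-1}} f(Rσ)² dσ = o(R^{-N})` as `R → ∞`. -/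
structure IsTestField {N : ℕ} (f : RN N → ℝ) : Prop where
  smooth : ContDiff ℝ ∞ f
  normD_lt_top : normD f < ⊤
  zero_mean : ∀ r : ℝ, 0 < r → sphereIntegral (fun σ => f (r • σ)) = 0
  decay : (fun R : ℝ => sphereIntegral (fun σ => f (R • σ) ^ 2)) =o[atTop]
    fun R : ℝ => R ^ (-(N : ℤ))

/-- The profile `(B₁ x₁ + ⋯ + B_N x_N) e^{-B₀ |x|²}`. -/
def gaussProfile {N : ℕ} (B₀ : ℝ) (B : Fin N → ℝ) (x : RN N) : ℝ :=
  (∑ k, B k * x k) * Real.exp (-B₀ * ‖x‖ ^ 2)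

end

/-! Write `A = ∫|∇f|²`, `B = ∫f²|x|²`, `C = ∫f²`. Zero mean on spheres makes `f` orthogonal to every
radial function, in particular to `exp(-a|x|²/2)` for each `a > 0` (`integral_mul_radial_eq_zero`).
Hence `g = f exp(a|x|²/2)` has mean zero for the Gaussian measure with density proportional to
`exp(-a|x|²)`, whose variance is `1/(2a)` in each coordinate. The Gaussian Poincaré inequality for
`g`, rewritten in terms of `f`, reads `2a C ≤ ∫|∇f + a f x|²`
(`lintegral_sq_le_of_integral_mul_exp_eq_zero`). Integrating by parts against the Euler field turns
the right side into `A - aNC + a²B`, so `a²B - a(N+2)C + A ≥ 0`, and the discriminant of this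
quadratic in `a` gives the claim (`uncertainty_of_zero_mean`).

The Poincaré inequality itself comes from dimension one by subadditivity of the variance on products
(`evariance_prod_le`, `evariance_pi_le_sum`). On the line the variance is at most `∫(h - h(0))²`,
and for a function `u` vanishing at the origin the inequality follows by integrating `(u²w/x)' ≤
(u'² - u²/v)w`, where `w` is the Gaussian density of variance `v`.

The profiles correspond, for `a = 2B₀`, to linear `g`, the equality case of the Poincaré inequality;
equality is verified by direct computation of moments. -/

/-! ### Variance with values in `[0, ∞]` and its tensorization -/

section Variance

open ProbabilityTheory

variable {Ω Ω' : Type*} {mΩ : MeasurableSpace Ω} {mΩ' : MeasurableSpace Ω'}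

theorem evariance_add_ofReal_sq_integral {μ : Measure Ω} [IsProbabilityMeasure μ] {X : Ω → ℝ}
    (hX : MemLp X 2 μ) :
    evariance X μ + ENNReal.ofReal (μ[X] ^ 2) = ∫⁻ a, ‖X a‖ₑ ^ 2 ∂μ := by
  have h1 : ∫⁻ a, ‖X a‖ₑ ^ 2 ∂μ = ENNReal.ofReal (∫ a, X a ^ 2 ∂μ) := by
    rw [ofReal_integral_eq_lintegral_ofReal hX.integrable_sq (ae_of_all _ fun _ => sq_nonneg _)]
    simp [← enorm_pow, Real.enorm_of_nonneg, sq_nonneg]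
  rw [h1, ← ofReal_variance hX, ← ENNReal.ofReal_add (variance_nonneg _ _) (sq_nonneg _),
    variance_eq_sub hX]
  simp

theorem enorm_integral_sq_le_lintegral {μ : Measure Ω} [IsProbabilityMeasure μ] {X : Ω → ℝ}
    (hX : MemLp X 2 μ) : ‖∫ a, X a ∂μ‖ₑ ^ 2 ≤ ∫⁻ a, ‖X a‖ₑ ^ 2 ∂μ := by
  rw [← evariance_add_ofReal_sq_integral hX, ← enorm_pow, Real.enorm_of_nonneg (sq_nonneg _)]
  exact le_add_self

/-- The mean is the best constant in `L²`. Outside `L²` the right side is infinite, so no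
integrability has to be assumed. -/
theorem evariance_le_lintegral_sub_const {μ : Measure Ω} [IsProbabilityMeasure μ] {X : Ω → ℝ}
    (hX : AEStronglyMeasurable X μ) (c : ℝ) :
    evariance X μ ≤ ∫⁻ a, ‖X a - c‖ₑ ^ 2 ∂μ := by
  have hXc : AEStronglyMeasurable (fun a => X a - c) μ := hX.sub aestronglyMeasurable_const
  by_cases hL : MemLp X 2 μ
  · have : evariance X μ = evariance (fun a => X a - c) μ := by
      simp [evariance, integral_sub (hL.integrable one_le_two) (integrable_const c)]
    rw [this, evariance_def' hXc]
    exact tsub_le_self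
  · have hL' : ¬ MemLp (fun a => X a - c) 2 μ := fun h => hL <| by
      simpa [Pi.add_def] using h.add (memLp_const c)
    have := evariance_eq_top hXc hL'
    rw [evariance_def' hXc] at this
    exact le_top.trans (this.ge.trans tsub_le_self)

/-- Subadditivity of the variance on a product of two probability spaces. -/
theorem evariance_prod_le {μ : Measure Ω} {ν : Measure Ω'} [IsProbabilityMeasure μ]
    [IsProbabilityMeasure ν] {g : Ω × Ω' → ℝ} (hg : Measurable g) (hL : MemLp g 2 (μ.prod ν)) :
    evariance g (μ.prod ν) ≤ (∫⁻ y, evariance (fun x => g (x, y)) μ ∂ν) +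
      ∫⁻ x, evariance (fun y => g (x, y)) ν ∂μ := by
  have hint : Integrable g (μ.prod ν) := hL.integrable one_le_two
  have hgs := hg.stronglyMeasurable
  set m := ∫ z, g z ∂(μ.prod ν) with hm
  set G : Ω' → ℝ := fun y => ∫ x, g (x, y) ∂μ with hG
  set H : Ω → ℝ := fun x => ∫ y, g (x, y) ∂ν with hH
  have hGm : Measurable G := (hgs.integral_prod_left' (μ := μ)).measurable
  have hHm : Measurable H := (hgs.integral_prod_right' (ν := ν)).measurable
  have hmG : ∫ y, G y ∂ν = m := (integral_prod_symm _ hint).symm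
  have hmH : ∫ x, H x ∂μ = m := (integral_prod _ hint).symm
  have hsq := hL.integrable_sq
  have secL : ∀ᵐ y ∂ν, MemLp (fun x => g (x, y)) 2 μ := by
    filter_upwards [hsq.prod_left_ae] with y hy
    exact (memLp_two_iff_integrable_sq
      (hg.comp measurable_prodMk_right).aestronglyMeasurable).2 hy
  have hmeas : Measurable fun z => ‖g z‖ₑ ^ 2 := by fun_prop
  have e1 : ∫⁻ z, ‖g z‖ₑ ^ 2 ∂(μ.prod ν) =
      (∫⁻ y, evariance (fun x => g (x, y)) μ ∂ν) + ∫⁻ y, ‖G y‖ₑ ^ 2 ∂ν := by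
    rw [lintegral_prod_symm' _ hmeas, ← lintegral_add_right _ (by fun_prop)]
    refine lintegral_congr_ae ?_
    filter_upwards [secL] with y hy
    rw [← evariance_add_ofReal_sq_integral hy, ← enorm_pow, Real.enorm_of_nonneg (sq_nonneg _)]
  have hGL : MemLp G 2 ν := by
    refine (memLp_two_iff_integrable_sq hGm.aestronglyMeasurable).2 ⟨by fun_prop, ?_⟩
    have hfin : ∫⁻ z, ‖g z‖ₑ ^ 2 ∂(μ.prod ν) < ⊤ := by
      simpa [hasFiniteIntegral_iff_enorm, enorm_pow] using hsq.2
    rw [hasFiniteIntegral_iff_enorm]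
    simp only [enorm_pow]
    exact (le_add_self.trans e1.ge).trans_lt hfin
  -- Law of total variance: subtract `m²` from the second moments in `e1`.
  have e2 : evariance g (μ.prod ν) ≤
      (∫⁻ y, evariance (fun x => g (x, y)) μ ∂ν) + evariance G ν := by
    rw [evariance_def' hL.1, e1, ← evariance_add_ofReal_sq_integral hGL, hmG, ← add_assoc]
    exact tsub_le_iff_right.2 le_rfl
  refine e2.trans (add_le_add_right ?_ _)
  have hmeas' : Measurable fun z : Ω × Ω' => ‖g z - H z.1‖ₑ ^ 2 := by fun_prop
  have hHi : Integrable H μ := hint.integral_prod_left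
  have hHL : MemLp H 2 μ := by
    refine (memLp_two_iff_integrable_sq hHm.aestronglyMeasurable).2 ?_
    refine Integrable.mono' hsq.integral_prod_left (by fun_prop) ?_
    filter_upwards [hsq.prod_right_ae] with x hx
    have hx2 : MemLp (fun y => g (x, y)) 2 ν := (memLp_two_iff_integrable_sq
      (hg.comp measurable_prodMk_left).aestronglyMeasurable).2 hx
    have := variance_nonneg (fun y => g (x, y)) ν
    rw [variance_eq_sub hx2] at this
    rw [Real.norm_of_nonneg (sq_nonneg _)]
    simpa using this
  -- Since `H` also has mean `m`, `G y - m` is the average over `x` of `g (x, y) - H x`. Jensen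
  -- moves the square inside, and Tonelli leaves the variance of each section in `y`.
  calc evariance G ν = ∫⁻ y, ‖G y - m‖ₑ ^ 2 ∂ν := by simp only [evariance, hmG]
    _ ≤ ∫⁻ y, ∫⁻ x, ‖g (x, y) - H x‖ₑ ^ 2 ∂μ ∂ν := by
      refine lintegral_mono_ae ?_
      filter_upwards [secL] with y hy
      rw [← hmH, hG, ← integral_sub (hy.integrable one_le_two) hHi]
      exact enorm_integral_sq_le_lintegral (hy.sub hHL)
    _ = ∫⁻ x, ∫⁻ y, ‖g (x, y) - H x‖ₑ ^ 2 ∂ν ∂μ := by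
      rw [← lintegral_prod_symm' _ hmeas', lintegral_prod _ hmeas'.aemeasurable]
    _ = _ := rfl

/-- Prepending a coordinate, as a map on pairs. -/
theorem measurableEmbedding_fin_cons (n : ℕ) : MeasurableEmbedding
    fun z : ℝ × (Fin n → ℝ) => (Fin.cons z.1 z.2 : Fin (n + 1) → ℝ) := by
  convert (MeasurableEquiv.piFinSuccAbove (fun _ : Fin (n + 1) => ℝ) 0).symm.measurableEmbedding
    using 1
  ext z i
  simp [MeasurableEquiv.piFinSuccAbove, Fin.insertNthEquiv]

theorem measurePreserving_fin_cons (μ : Measure ℝ) [SigmaFinite μ] (n : ℕ) : MeasurePreserving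
    (fun z : ℝ × (Fin n → ℝ) => (Fin.cons z.1 z.2 : Fin (n + 1) → ℝ))
    (μ.prod (Measure.pi fun _ => μ)) (Measure.pi fun _ => μ) := by
  convert (measurePreserving_piFinSuccAbove (fun _ : Fin (n + 1) => μ) 0).symm using 1
  ext z i
  simp [MeasurableEquiv.piFinSuccAbove, Fin.insertNthEquiv]

/-- Tensorization: a bound of the variance along each coordinate by the integral of an energy
density bounds the variance for the product measure by the total energy. -/
theorem evariance_pi_le_sum {μ : Measure ℝ} [IsProbabilityMeasure μ] :
    ∀ (n : ℕ) (g : (Fin n → ℝ) → ℝ) (D : Fin n → (Fin n → ℝ) → ℝ≥0∞), Measurable g →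
      (∀ i, Measurable (D i)) → MemLp g 2 (Measure.pi fun _ => μ) →
      (∀ i x, evariance (fun s => g (Function.update x i s)) μ ≤
        ∫⁻ s, D i (Function.update x i s) ∂μ) →
      evariance g (Measure.pi fun _ => μ) ≤ ∑ i, ∫⁻ x, D i x ∂(Measure.pi fun _ => μ)
  | 0, g, D, _, _, _, _ => by
    have : evariance g (Measure.pi fun _ : Fin 0 => μ) = 0 := by
      have hc : g = fun _ => g default := funext fun x => congrArg g (Subsingleton.elim _ _)
      rw [hc]; simp [evariance]
    simp [this]
  | n + 1, g, D, hg, hD, hL, hb => by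
    have mp := measurePreserving_fin_cons μ n
    have me := measurableEmbedding_fin_cons n
    set π : Measure (Fin n → ℝ) := Measure.pi fun _ => μ with hπ
    set e : ℝ × (Fin n → ℝ) → (Fin (n + 1) → ℝ) := fun z => Fin.cons z.1 z.2 with he
    have hem : Measurable e := me.measurable
    have hg' : Measurable (g ∘ e) := hg.comp hem
    have hL' : MemLp (g ∘ e) 2 (μ.prod π) := hL.comp_measurePreserving mp
    have hlin : ∀ F : (Fin (n + 1) → ℝ) → ℝ≥0∞, ∫⁻ x, F x ∂(Measure.pi fun _ => μ) =
        ∫⁻ z, F (e z) ∂(μ.prod π) := fun F => (mp.lintegral_comp_emb me F).symm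
    have hev : evariance g (Measure.pi fun _ => μ) = evariance (g ∘ e) (μ.prod π) := by
      simp only [evariance, hlin, Function.comp_apply]
      rw [← mp.integral_comp me]
    rw [hev, Fin.sum_univ_succ]
    refine (evariance_prod_le hg' hL').trans (add_le_add ?_ ?_)
    · rw [hlin, lintegral_prod_symm' (fun z => D 0 (e z)) ((hD 0).comp hem)]
      refine lintegral_mono fun y => ?_
      have := hb 0 (e (0, y))
      simpa only [he, Fin.update_cons_zero, Function.comp_apply] using this
    · have secL : ∀ᵐ t ∂μ, MemLp (fun y => g (e (t, y))) 2 π := by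
        filter_upwards [hL'.integrable_sq.prod_right_ae] with t ht
        exact (memLp_two_iff_integrable_sq
          (hg'.comp measurable_prodMk_left).aestronglyMeasurable).2 ht
      calc ∫⁻ t, evariance (fun y => g (e (t, y))) π ∂μ
          ≤ ∫⁻ t, ∑ i : Fin n, ∫⁻ y, D i.succ (e (t, y)) ∂π ∂μ := by
            refine lintegral_mono_ae ?_
            filter_upwards [secL] with t ht
            refine evariance_pi_le_sum n (fun y => g (e (t, y))) (fun i y => D i.succ (e (t, y)))
              (hg'.comp measurable_prodMk_left)
              (fun i => ((hD _).comp hem).comp measurable_prodMk_left) ht fun i y => ?_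
            have := hb i.succ (e (t, y))
            simpa only [he, Fin.cons_update] using this
        _ = _ := by
            rw [lintegral_finsetSum _ fun i _ =>
              ((hD i.succ).comp hem).lintegral_prod_right']
            refine Finset.sum_congr rfl fun i _ => ?_
            rw [hlin, lintegral_prod (fun z => D i.succ (e z)) ((hD i.succ).comp hem).aemeasurable]

end Variance

/-! ### Products of measures with densities -/

section ProductDensity

theorem lintegral_pi_prod : ∀ (n : ℕ) (p : Fin n → ℝ → ℝ≥0∞), (∀ i, Measurable (p i)) →
    ∫⁻ x : Fin n → ℝ, ∏ i, p i (x i) = ∏ i, ∫⁻ t, p i t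
  | 0, p, _ => by simp [volume_pi]
  | n + 1, p, hp => by
    have hm : Measurable fun x : Fin n → ℝ => ∏ i, p i.succ (x i) :=
      Finset.measurable_prod _ fun i _ => (hp _).comp (measurable_pi_apply _)
    rw [volume_pi, ← (measurePreserving_fin_cons volume n).lintegral_comp_emb
      (measurableEmbedding_fin_cons n)]
    simp only [Fin.prod_univ_succ, Fin.cons_zero, Fin.cons_succ]
    rw [lintegral_prod_mul (hp 0).aemeasurable hm.aemeasurable, ← volume_pi,
      lintegral_pi_prod n (fun i => p i.succ) fun i => hp _]

theorem pi_withDensity {n : ℕ} {p : ℝ → ℝ≥0∞} (hp : Measurable p)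
    [SigmaFinite (volume.withDensity p)] :
    (Measure.pi fun _ : Fin n => (volume : Measure ℝ).withDensity p) =
      (volume : Measure (Fin n → ℝ)).withDensity fun x => ∏ i, p (x i) := by
  refine Measure.pi_eq fun s hs => ?_
  rw [withDensity_apply _ (MeasurableSet.univ_pi hs),
    ← lintegral_indicator (MeasurableSet.univ_pi hs)]
  have : ((Set.univ.pi s).indicator fun x : Fin n → ℝ => ∏ i, p (x i)) =
      fun x => ∏ i, (s i).indicator p (x i) := by
    ext x
    by_cases hx : x ∈ Set.univ.pi s
    · rw [Set.indicator_of_mem hx]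
      exact Finset.prod_congr rfl fun i _ => (Set.indicator_of_mem (hx i trivial) _).symm
    · rw [Set.indicator_of_notMem hx]
      simp only [Set.mem_pi, Set.mem_univ, true_imp_iff, not_forall] at hx
      obtain ⟨i, hi⟩ := hx
      exact (Finset.prod_eq_zero (Finset.mem_univ i) (Set.indicator_of_notMem hi _)).symm
  rw [this, lintegral_pi_prod n (fun i => (s i).indicator p) fun i => hp.indicator (hs i)]
  refine Finset.prod_congr rfl fun i _ => ?_
  rw [withDensity_apply _ (hs i), lintegral_indicator (hs i)]

end ProductDensity

/-! ### The Gaussian Poincaré inequality on the line -/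

section OneDimensional

open ProbabilityTheory
open scoped NNReal Topology

theorem hasDerivAt_gaussianPDFReal_zero {v : ℝ≥0} (x : ℝ) :
    HasDerivAt (gaussianPDFReal 0 v) (-(x / v) * gaussianPDFReal 0 v x) x := by
  have h : HasDerivAt (fun y : ℝ => -(y - 0) ^ 2 / (2 * v)) (-(x / v)) x := by
    have := ((((hasDerivAt_id x).sub_const 0).pow 2).neg.div_const (2 * (v : ℝ)))
    convert! this using 1
    simp; ring
  rw [gaussianPDFReal_def]
  convert! (h.exp.const_mul _) using 1
  ring

/-- The quotient `u² w / x` of a function vanishing at the origin: its derivative, and the bound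
`(u² w / x)' ≤ (u'² - u² / v) w`. -/
theorem hasDerivAt_sq_mul_gaussianPDFReal_div {v : ℝ≥0} {u u' : ℝ → ℝ}
    (hu : ∀ x, HasDerivAt u (u' x) x) (h0 : u 0 = 0) (x : ℝ) :
    ∃ d, HasDerivAt (fun y => u y ^ 2 * gaussianPDFReal 0 v y / y) d x ∧
      d ≤ (u' x ^ 2 - u x ^ 2 / v) * gaussianPDFReal 0 v x := by
  have hw := hasDerivAt_gaussianPDFReal_zero (v := v) x
  have hwp := gaussianPDFReal_nonneg 0 v x
  rcases eq_or_ne x 0 with rfl | hx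
  -- Division by zero gives the quotient the value `0` at the origin, so its slope there is `(u y /
  -- y)² w y`, which tends to `u'(0)² w(0)`.
  · refine ⟨u' 0 ^ 2 * gaussianPDFReal 0 v 0, ?_, by simp [h0]⟩
    rw [hasDerivAt_iff_tendsto_slope] 
    have h1 := (hasDerivAt_iff_tendsto_slope.1 (hu 0)).pow 2
    have h2 := h1.mul (hw.continuousAt.tendsto.mono_left (nhdsWithin_le_nhds (s := {0}ᶜ)))
    refine h2.congr' ?_
    filter_upwards [self_mem_nhdsWithin] with y hy
    simp [slope_def_field, h0]
    have : y ≠ 0 := hy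
    field_simp
  · refine ⟨_, (((hu x).pow 2).mul hw).div (hasDerivAt_id x) hx, ?_⟩
    -- As `w' = -(x/v) w`, this square is exactly the gap between the two sides.
    have key : 0 ≤ (u' x - u x / x) ^ 2 * gaussianPDFReal 0 v x := by positivity
    refine le_of_sub_nonneg (key.trans_eq ?_)
    simp
    field_simp
    ring

/-- The derivative bound for `u²w/x` is integrated over `[-n, n]`, where the boundary terms have a
favourable sign; then `n → ∞`. No growth condition on `u` is needed. -/
theorem lintegral_sq_gaussianReal_le {v : ℝ≥0} (hv : v ≠ 0) {u u' : ℝ → ℝ}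
    (hu : ∀ x, HasDerivAt u (u' x) x) (hu' : Continuous u') (h0 : u 0 = 0) :
    ∫⁻ x, ‖u x‖ₑ ^ 2 ∂(gaussianReal 0 v) ≤ v * ∫⁻ x, ‖u' x‖ₑ ^ 2 ∂(gaussianReal 0 v) := by
  have hv' : (0 : ℝ) < v := by positivity
  set w := gaussianPDFReal 0 v with hw
  have hwp : ∀ x, 0 ≤ w x := gaussianPDFReal_nonneg 0 v
  have hwc : Continuous w :=
    continuous_iff_continuousAt.2 fun x => (hasDerivAt_gaussianPDFReal_zero x).continuousAt
  have huc : Continuous u := continuous_iff_continuousAt.2 fun x => (hu x).continuousAt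
  have conv : ∀ k : ℝ → ℝ, Continuous k → ∫⁻ x, ‖k x‖ₑ ^ 2 ∂(gaussianReal 0 v) =
      ∫⁻ x, ENNReal.ofReal (k x ^ 2 * w x) := fun k hk => by
    rw [gaussianReal_of_var_ne_zero _ hv, lintegral_withDensity_eq_lintegral_mul _
      (measurable_gaussianPDF 0 v) (by fun_prop)]
    refine lintegral_congr fun x => ?_
    rw [Pi.mul_apply, gaussianPDF, ← enorm_pow, Real.enorm_of_nonneg (sq_nonneg _), mul_comm,
      ENNReal.ofReal_mul (sq_nonneg _)]
  rw [conv u huc, conv u' hu', ← ENNReal.ofReal_coe_nnreal,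
    ← lintegral_const_mul _ (by fun_prop)]
  have hd := hasDerivAt_sq_mul_gaussianPDFReal_div (v := v) hu h0
  choose d hd hle using hd
  have bound : ∀ n : ℕ, ∫⁻ x in Set.Icc (-(n : ℝ)) n, ENNReal.ofReal (u x ^ 2 * w x) ≤
      ∫⁻ x, ENNReal.ofReal v * ENNReal.ofReal (u' x ^ 2 * w x) := fun n => by
    have hn : -(n : ℝ) ≤ n := by linarith [Nat.cast_nonneg (α := ℝ) n]
    have hcont : Continuous fun x => (u' x ^ 2 - u x ^ 2 / v) * w x := by fun_prop
    -- This form of the fundamental theorem needs integrability of the upper bound only, not of the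
    -- derivative `d`.
    have h1 := intervalIntegral.sub_le_integral_of_hasDeriv_right_of_le hn
      (fun x _ => (hd x).continuousAt.continuousWithinAt)
      (fun x _ => (hd x).hasDerivWithinAt) hcont.continuousOn.integrableOn_Icc
      (fun x _ => hle x)
    have h2 : 0 ≤ u n ^ 2 * w n / n - u (-n) ^ 2 * w (-n) / (-n) := by
      have a1 : 0 ≤ u n ^ 2 * w n / n := by have := hwp n; positivity
      have a2 : 0 ≤ u (-n) ^ 2 * w (-n) / n := by have := hwp (-n); positivity
      rw [div_neg]; linarith
    have h3 := h2.trans h1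
    have c1 : Continuous fun x => u x ^ 2 * w x := by fun_prop
    have c2 : Continuous fun x => v * (u' x ^ 2 * w x) := by fun_prop
    have h4 : ∫ x in Set.Icc (-(n : ℝ)) n, u x ^ 2 * w x ≤
        ∫ x in Set.Icc (-(n : ℝ)) n, v * (u' x ^ 2 * w x) := by
      rw [integral_Icc_eq_integral_Ioc, integral_Icc_eq_integral_Ioc,
        ← intervalIntegral.integral_of_le hn, ← intervalIntegral.integral_of_le hn]
      have : (∫ x in -(n : ℝ)..n, v * (u' x ^ 2 * w x)) - ∫ x in -(n : ℝ)..n, u x ^ 2 * w x =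
          v * ∫ x in -(n : ℝ)..n, (u' x ^ 2 - u x ^ 2 / v) * w x := by
        rw [← intervalIntegral.integral_sub (c2.intervalIntegrable _ _) (c1.intervalIntegrable _ _),
          ← intervalIntegral.integral_const_mul]
        refine intervalIntegral.integral_congr fun x _ => ?_
        field_simp
      have := this.trans_ge (mul_nonneg hv'.le h3)
      linarith
    calc ∫⁻ x in Set.Icc (-(n : ℝ)) n, ENNReal.ofReal (u x ^ 2 * w x)
        = ENNReal.ofReal (∫ x in Set.Icc (-(n : ℝ)) n, u x ^ 2 * w x) :=
          (ofReal_integral_eq_lintegral_ofReal c1.continuousOn.integrableOn_Icc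
            (ae_of_all _ fun x => mul_nonneg (sq_nonneg _) (hwp x))).symm
      _ ≤ ENNReal.ofReal (∫ x in Set.Icc (-(n : ℝ)) n, v * (u' x ^ 2 * w x)) :=
          ENNReal.ofReal_le_ofReal h4
      _ = ∫⁻ x in Set.Icc (-(n : ℝ)) n, ENNReal.ofReal (v * (u' x ^ 2 * w x)) :=
          ofReal_integral_eq_lintegral_ofReal c2.continuousOn.integrableOn_Icc
            (ae_of_all _ fun x => mul_nonneg hv'.le (mul_nonneg (sq_nonneg _) (hwp x)))
      _ = ∫⁻ x in Set.Icc (-(n : ℝ)) n, ENNReal.ofReal v * ENNReal.ofReal (u' x ^ 2 * w x) :=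
          lintegral_congr fun x => ENNReal.ofReal_mul hv'.le
      _ ≤ _ := setLIntegral_le_lintegral _ _
  have cov : AECover volume atTop fun n : ℕ => Set.Icc (-(n : ℝ)) n :=
    aecover_Icc (tendsto_neg_atTop_atBot.comp tendsto_natCast_atTop_atTop)
      tendsto_natCast_atTop_atTop
  exact le_of_tendsto' (cov.lintegral_tendsto_of_countably_generated (by fun_prop)) bound

/-- The Poincaré inequality for a centred Gaussian measure on the line. -/
theorem evariance_gaussianReal_le {v : ℝ≥0} (hv : v ≠ 0) {h h' : ℝ → ℝ}
    (hh : ∀ x, HasDerivAt h (h' x) x) (hh' : Continuous h') :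
    evariance h (gaussianReal 0 v) ≤ v * ∫⁻ x, ‖h' x‖ₑ ^ 2 ∂(gaussianReal 0 v) := by
  have hc : Continuous h := continuous_iff_continuousAt.2 fun x => (hh x).continuousAt
  -- Centring at `h 0` instead of the mean produces a function vanishing at the origin.
  exact (evariance_le_lintegral_sub_const hc.aestronglyMeasurable (h 0)).trans
    (lintegral_sq_gaussianReal_le hv (fun x => (hh x).sub_const (h 0)) hh' (sub_self _))

end OneDimensional

/-! ### The Gaussian Poincaré inequality in `ℝ^N` and its form for Lebesgue measure -/

section GaussianPoincare

open ProbabilityTheory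
open scoped NNReal Topology

theorem HasGradientAt.mul_exp_norm_sq {N : ℕ} {f : RN N → ℝ} {f' x : RN N}
    (hf : HasGradientAt f f' x) (a : ℝ) :
    HasGradientAt (fun y => f y * Real.exp (a * ‖y‖ ^ 2))
      (Real.exp (a * ‖x‖ ^ 2) • (f' + (2 * a * f x) • x)) x := by
  rw [hasGradientAt_iff_hasFDerivAt] at hf ⊢
  have h := hf.mul (((hasStrictFDerivAt_norm_sq x).hasFDerivAt.const_mul a).exp)
  convert! h using 1
  ext v
  simp
  ring

theorem continuous_gradient {N : ℕ} {f : RN N → ℝ} (hf : ContDiff ℝ 1 f) :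
    Continuous fun x => ∇ f x :=
  (InnerProductSpace.toDual ℝ (RN N)).symm.continuous.comp (hf.continuous_fderiv one_ne_zero)

theorem enorm_sq_eq_sum {N : ℕ} (x : RN N) : ‖x‖ₑ ^ 2 = ∑ i, ‖x i‖ₑ ^ 2 := by
  have h : ∀ r : ℝ, ‖r‖ₑ ^ 2 = ENNReal.ofReal (r ^ 2) := fun r => by
    rw [← enorm_pow, Real.enorm_of_nonneg (sq_nonneg _)]
  simp only [h]
  rw [← ENNReal.ofReal_sum_of_nonneg fun i _ => sq_nonneg _, ← EuclideanSpace.real_norm_sq_eq, ← h,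
    enorm_norm]

/-- The centred Gaussian measure on `ℝ^N` with covariance `v`. -/
noncomputable def gaussianRN (N : ℕ) (v : ℝ≥0) : Measure (RN N) :=
  (Measure.pi fun _ : Fin N => gaussianReal 0 v).map (WithLp.toLp 2)

theorem measurePreserving_gaussianRN (N : ℕ) (v : ℝ≥0) :
    MeasurePreserving (WithLp.toLp 2) (Measure.pi fun _ : Fin N => gaussianReal 0 v)
      (gaussianRN N v) :=
  ⟨(MeasurableEquiv.toLp 2 _).measurable, rfl⟩

instance (N : ℕ) (v : ℝ≥0) : IsProbabilityMeasure (gaussianRN N v) :=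
  Measure.isProbabilityMeasure_map (measurePreserving_gaussianRN N v).aemeasurable

theorem measurableEmbedding_toLp (N : ℕ) :
    MeasurableEmbedding (WithLp.toLp 2 : (Fin N → ℝ) → RN N) :=
  (MeasurableEquiv.toLp 2 _).measurableEmbedding

/-- The normalizing constant is left anonymous because it cancels from the Poincaré inequality. -/
theorem gaussianRN_eq_withDensity (N : ℕ) {v : ℝ≥0} (hv : v ≠ 0) :
    ∃ C : ℝ, 0 < C ∧ gaussianRN N v = volume.withDensity fun x =>
      ENNReal.ofReal (C * Real.exp (-(2 * (v : ℝ))⁻¹ * ‖x‖ ^ 2)) := by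
  refine ⟨((√(2 * Real.pi * v))⁻¹) ^ N, by positivity, ?_⟩
  have hσ : SigmaFinite ((volume : Measure ℝ).withDensity (gaussianPDF 0 v)) := by
    rw [← gaussianReal_of_var_ne_zero _ hv]; infer_instance
  ext s hs
  have hm := (measurableEmbedding_toLp N).measurable
  rw [gaussianRN, Measure.map_apply hm hs, gaussianReal_of_var_ne_zero _ hv,
    pi_withDensity (measurable_gaussianPDF 0 v), withDensity_apply _ (hm hs),
    withDensity_apply _ hs, ← (PiLp.volume_preserving_toLp (Fin N)).setLIntegral_comp_preimage_emb
      (measurableEmbedding_toLp N)]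
  refine lintegral_congr fun y => ?_
  simp only [gaussianPDF]
  rw [← ENNReal.ofReal_prod_of_nonneg fun i _ => gaussianPDFReal_nonneg _ _ _]
  congr 1
  simp only [gaussianPDFReal, Finset.prod_mul_distrib, Finset.prod_const, ← Real.exp_sum,
    EuclideanSpace.real_norm_sq_eq, Finset.mul_sum, Finset.card_univ, Fintype.card_fin, sub_zero]
  congr 2
  refine Finset.sum_congr rfl fun i _ => ?_
  ring

/-- The Poincaré inequality for centred Gaussian measures on `ℝ^N`. -/
theorem evariance_gaussianRN_le {N : ℕ} {v : ℝ≥0} (hv : v ≠ 0) {g : RN N → ℝ}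
    (hg : ContDiff ℝ 1 g) (hL : MemLp g 2 (gaussianRN N v)) :
    evariance g (gaussianRN N v) ≤ v * ∫⁻ x, ‖∇ g x‖ₑ ^ 2 ∂(gaussianRN N v) := by
  have mp := measurePreserving_gaussianRN N v
  have me := measurableEmbedding_toLp N
  have hgrad := continuous_gradient hg
  have hcont : ∀ i, Continuous fun x => (∇ g x) i := fun i =>
    (EuclideanSpace.proj i : RN N →L[ℝ] ℝ).continuous.comp hgrad
  have hev : evariance g (gaussianRN N v) =
      evariance (fun y => g (WithLp.toLp 2 y)) (Measure.pi fun _ : Fin N => gaussianReal 0 v) := by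
    simp only [evariance]
    rw [mp.integral_comp me, ← mp.lintegral_comp_emb me]
  rw [hev]
  refine (evariance_pi_le_sum N _
    (fun i y => v * ‖(∇ g (WithLp.toLp 2 y)) i‖ₑ ^ 2)
    (hg.continuous.measurable.comp me.measurable)
    (fun i => (((hcont i).measurable.comp me.measurable).enorm.pow_const 2).const_mul _)
    (hL.comp_measurePreserving mp) fun i y => ?_).trans_eq ?_
  · have hd : ∀ s, HasDerivAt (fun s => g (WithLp.toLp 2 (Function.update y i s)))
        ((∇ g (WithLp.toLp 2 (Function.update y i s))) i) s := fun s => by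
      have h1 := ((PiLp.continuousLinearEquiv 2 ℝ fun _ : Fin N => ℝ).symm :
        (Fin N → ℝ) →L[ℝ] RN N).hasFDerivAt.comp_hasDerivAt s (hasDerivAt_update y i s)
      have h2 := ((hg.differentiable one_ne_zero
        (WithLp.toLp 2 (Function.update y i s))).hasFDerivAt).comp_hasDerivAt s h1
      convert! h2 using 1
      have h3 := EuclideanSpace.inner_single_right i (1 : ℝ)
        (∇ g (WithLp.toLp 2 (Function.update y i s)))
      rw [inner_gradient_left] at h3
      simpa using h3.symm
    have hc : Continuous fun s => (∇ g (WithLp.toLp 2 (Function.update y i s))) i :=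
      (hcont i).comp ((PiLp.continuous_toLp 2 _).comp (by fun_prop))
    refine (evariance_gaussianReal_le hv hd hc).trans_eq ?_
    rw [lintegral_const_mul _ (by fun_prop)]
  · have hm : ∀ i ∈ Finset.univ, Measurable fun y : Fin N → ℝ =>
        (v : ℝ≥0∞) * ‖(∇ g (WithLp.toLp 2 y)) i‖ₑ ^ 2 := fun i _ =>
      (((hcont i).measurable.comp me.measurable).enorm.pow_const 2).const_mul _
    rw [← mp.lintegral_comp_emb me, ← lintegral_finsetSum _ hm,
      ← lintegral_const_mul _ (by
        exact (hgrad.measurable.comp me.measurable).enorm.pow_const 2)]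
    simp only [enorm_sq_eq_sum, Finset.mul_sum]

/-- The harmonic oscillator form of the Gaussian Poincaré inequality. -/
theorem lintegral_sq_le_of_integral_mul_exp_eq_zero {N : ℕ} {a : ℝ} (ha : 0 < a) {f : RN N → ℝ}
    (hf : ContDiff ℝ 1 f) (hL : Integrable fun x => f x ^ 2)
    (h0 : ∫ x, f x * Real.exp (-(a / 2) * ‖x‖ ^ 2) = 0) :
    ENNReal.ofReal (2 * a) * ∫⁻ x, ‖f x‖ₑ ^ 2 ≤ ∫⁻ x, ‖∇ f x + (a * f x) • x‖ₑ ^ 2 := by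
  -- With this variance the density is `C exp(-a|x|²)`, and `exp(a|x|²/2)` is, up to a constant, the
  -- inverse of its square root.
  set v : ℝ≥0 := ⟨(2 * a)⁻¹, by positivity⟩ with hv
  have hvr : (v : ℝ) = (2 * a)⁻¹ := rfl
  have hv0 : v ≠ 0 := by
    rw [← NNReal.coe_ne_zero, hvr]; positivity
  obtain ⟨C, hC, hΓ⟩ := gaussianRN_eq_withDensity N hv0
  have hexp : (2 * (v : ℝ))⁻¹ = a := by rw [hvr]; field_simp
  rw [hexp] at hΓ
  set Γ := gaussianRN N v
  set g : RN N → ℝ := fun x => f x * Real.exp (a / 2 * ‖x‖ ^ 2) with hg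
  have hgc : ContDiff ℝ 1 g := hf.mul (contDiff_const.mul (contDiff_norm_sq ℝ)).exp
  have hgg : ∀ x, ∇ g x = Real.exp (a / 2 * ‖x‖ ^ 2) • (∇ f x + (a * f x) • x) := fun x => by
    have := ((hf.differentiable one_ne_zero x).hasGradientAt.mul_exp_norm_sq (a / 2)).gradient
    rw [hg, this]
    congr 4
    ring
  have hρm : Measurable fun x : RN N => ENNReal.ofReal (C * Real.exp (-a * ‖x‖ ^ 2)) := by fun_prop
  -- The squared exponential cancels the density. This is applied both to `f` and to the vector
  -- field `∇f + a f x`.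
  have hlin : ∀ {E : Type} [NormedAddCommGroup E] [NormedSpace ℝ E] (k : RN N → E),
      Continuous k → ∫⁻ x, ‖Real.exp (a / 2 * ‖x‖ ^ 2) • k x‖ₑ ^ 2 ∂Γ =
        ENNReal.ofReal C * ∫⁻ x, ‖k x‖ₑ ^ 2 := fun k hk => by
    have hkm : Measurable fun x => ‖k x‖ₑ ^ 2 := hk.enorm.measurable.pow_const 2
    have hkm' : Measurable fun x => ‖Real.exp (a / 2 * ‖x‖ ^ 2) • k x‖ₑ ^ 2 := by
      have hc : Continuous fun x => Real.exp (a / 2 * ‖x‖ ^ 2) • k x := by fun_prop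
      exact hc.enorm.measurable.pow_const 2
    rw [hΓ, lintegral_withDensity_eq_lintegral_mul _ hρm hkm', ← lintegral_const_mul _ hkm]
    refine lintegral_congr fun x => ?_
    simp only [Pi.mul_apply, enorm_smul, mul_pow]
    rw [Real.enorm_of_nonneg (Real.exp_nonneg _), ← ENNReal.ofReal_pow (Real.exp_nonneg _),
      ← mul_assoc, ← ENNReal.ofReal_mul (by positivity), mul_assoc C, ← Real.exp_nat_mul,
      ← Real.exp_add]
    congr 3
    convert mul_one C
    rw [Real.exp_eq_one_iff]
    push_cast
    ring
  have hfin : ∫⁻ x, ‖f x‖ₑ ^ 2 < ⊤ := by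
    simpa [hasFiniteIntegral_iff_enorm, enorm_pow] using hL.2
  have hgsq : ∫⁻ x, ‖g x‖ₑ ^ 2 ∂Γ = ENNReal.ofReal C * ∫⁻ x, ‖f x‖ₑ ^ 2 := by
    rw [← hlin f hf.continuous]
    simp only [hg, smul_eq_mul, mul_comm]
  have hgL : MemLp g 2 Γ := by
    refine (memLp_two_iff_integrable_sq hgc.continuous.aestronglyMeasurable).2
      ⟨(hgc.continuous.pow 2).aestronglyMeasurable, ?_⟩
    rw [hasFiniteIntegral_iff_enorm]
    simp only [enorm_pow]
    rw [hgsq]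
    exact ENNReal.mul_lt_top ENNReal.ofReal_lt_top hfin
  -- The weight `exp(a|x|²/2)` against the density `C exp(-a|x|²)` leaves `C exp(-a|x|²/2)`, so the
  -- orthogonality hypothesis applies.
  have hmean : ∫ x, g x ∂Γ = 0 := by
    rw [hΓ, integral_withDensity_eq_integral_toReal_smul hρm (by simp)]
    rw [← mul_zero C, ← h0, ← integral_const_mul]
    refine integral_congr_ae (ae_of_all _ fun x => ?_)
    simp only [hg, smul_eq_mul]
    rw [ENNReal.toReal_ofReal (by positivity)]
    rw [show -(a / 2) * ‖x‖ ^ 2 = -a * ‖x‖ ^ 2 + a / 2 * ‖x‖ ^ 2 by ring, Real.exp_add]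
    ring
  have hP := evariance_gaussianRN_le hv0 hgc hgL
  have hevar : evariance g Γ = ∫⁻ x, ‖g x‖ₑ ^ 2 ∂Γ := by
    rw [← evariance_add_ofReal_sq_integral hgL, hmean]; simp
  have hgf := continuous_gradient hf
  have hfc := hf.continuous
  change _ ≤ _ * ∫⁻ x, ‖∇ g x‖ₑ ^ 2 ∂Γ at hP
  simp only [hgg] at hP
  rw [hevar, hgsq, hlin _ (by fun_prop), ← mul_assoc, mul_comm (v : ℝ≥0∞), mul_assoc] at hP
  have hP' := (ENNReal.mul_le_mul_iff_right (by simpa using hC) ENNReal.ofReal_ne_top).1 hP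
  calc _ ≤ ENNReal.ofReal (2 * a) * (v * ∫⁻ x, ‖∇ f x + (a * f x) • x‖ₑ ^ 2) := by gcongr
    _ = _ := by
      rw [← mul_assoc, ← ENNReal.ofReal_coe_nnreal, ← ENNReal.ofReal_mul (by positivity), hvr,
        mul_inv_cancel₀ (by positivity), ENNReal.ofReal_one, one_mul]

end GaussianPoincare

/-! ### Integration by parts, radial orthogonality and the uncertainty inequality -/

section Uncertainty

open Module

/-- Integration by parts against the constant function `1`. -/
theorem integral_fderiv_apply_eq_zero {N : ℕ} {h : RN N → ℝ} {h' : RN N → RN N →L[ℝ] ℝ} (v : RN N)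
    (hh : ∀ x, HasFDerivAt h (h' x) x) (hi : Integrable h) (hi' : Integrable fun x => h' x v) :
    ∫ x, h' x v = 0 := by
  have := integral_bilinear_hasFDerivAt_right_eq_neg_left_of_integrable
    (μ := (volume : Measure (RN N))) (f := fun _ => (1 : ℝ)) (f' := fun _ => 0) (g := h) (g' := h')
    (v := v) (B := ContinuousLinearMap.mul ℝ ℝ) (by simp) (by simpa using hi') (by simpa using hi)
    (fun x _ => hasFDerivAt_const _ _) (fun x _ => hh x)
  simpa using this

theorem abs_coord_le_norm {N : ℕ} (x : RN N) (i : Fin N) : |x i| ≤ ‖x‖ := by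
  simpa using PiLp.norm_apply_le x i

theorem integrable_mul_norm_mul_norm_gradient {N : ℕ} {f : RN N → ℝ} (hf : ContDiff ℝ 1 f)
    (h1 : Integrable fun x => f x ^ 2 * ‖x‖ ^ 2) (h2 : Integrable fun x => ‖∇ f x‖ ^ 2) :
    Integrable fun x => |f x| * ‖x‖ * ‖∇ f x‖ := by
  have hg := continuous_gradient hf
  have hc := hf.continuous
  refine (h1.add h2).mono' (by fun_prop) (ae_of_all _ fun x => ?_)
  rw [Real.norm_of_nonneg (by positivity)]
  have := two_mul_le_add_sq (|f x| * ‖x‖) ‖∇ f x‖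
  simp only [Pi.add_apply]
  rw [mul_pow, sq_abs] at this
  have : 0 ≤ |f x| * ‖x‖ * ‖∇ f x‖ := by positivity
  linarith

theorem integrable_mul_inner_gradient {N : ℕ} {f : RN N → ℝ} (hf : ContDiff ℝ 1 f)
    (h1 : Integrable fun x => f x ^ 2 * ‖x‖ ^ 2) (h2 : Integrable fun x => ‖∇ f x‖ ^ 2) :
    Integrable fun x => f x * inner ℝ (∇ f x) x := by
  have hg := continuous_gradient hf
  have hc := hf.continuous
  refine (integrable_mul_norm_mul_norm_gradient hf h1 h2).mono' (by fun_prop)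
    (ae_of_all _ fun x => ?_)
  rw [norm_mul, Real.norm_eq_abs, mul_assoc]
  gcongr
  exact (norm_inner_le_norm _ _).trans_eq (mul_comm _ _)

/-- Integration by parts against the Euler field. -/
theorem two_mul_integral_mul_inner_gradient {N : ℕ} {f : RN N → ℝ} (hf : ContDiff ℝ 1 f)
    (h0 : Integrable fun x => f x ^ 2) (h1 : Integrable fun x => f x ^ 2 * ‖x‖ ^ 2)
    (h2 : Integrable fun x => ‖∇ f x‖ ^ 2) :
    2 * ∫ x, f x * inner ℝ (∇ f x) x = -(N * ∫ x, f x ^ 2) := by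
  have hg := continuous_gradient hf
  have hc := hf.continuous
  have hgi : ∀ i, Continuous fun x => (∇ f x) i := fun i =>
    (EuclideanSpace.proj i : RN N →L[ℝ] ℝ).continuous.comp hg
  have hI : ∀ i : Fin N, Integrable fun x => f x ^ 2 + 2 * (f x * (x i * (∇ f x) i)) := fun i => by
    refine h0.add (((integrable_mul_norm_mul_norm_gradient hf h1 h2).mono'
      (hc.mul (Continuous.mul (by fun_prop) (hgi i))).aestronglyMeasurable
      (ae_of_all _ fun x => ?_)).const_mul 2)
    simp only [Pi.mul_apply, norm_mul, Real.norm_eq_abs, ← mul_assoc]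
    gcongr
    · exact abs_coord_le_norm x i
    · exact abs_coord_le_norm _ i
  -- The integrand is the `i`-th partial derivative of `x_i f²`, which is integrable since `|x_i| ≤
  -- 1 + |x|²`.
  have key : ∀ i : Fin N, ∫ x, (f x ^ 2 + 2 * (f x * (x i * (∇ f x) i))) = 0 := fun i => by
    have hd : ∀ x, HasFDerivAt (fun y : RN N => y i * f y ^ 2) _ x := fun x =>
      ((EuclideanSpace.proj i : RN N →L[ℝ] ℝ).hasFDerivAt (x := x)).mul
        ((hf.differentiable one_ne_zero x).hasFDerivAt.pow 2)
    have heq : ∀ x, (x i • ((2 • f x ^ (2 - 1)) • fderiv ℝ f x) +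
        f x ^ 2 • (EuclideanSpace.proj i : RN N →L[ℝ] ℝ)) (EuclideanSpace.single i 1) =
        f x ^ 2 + 2 * (f x * (x i * (∇ f x) i)) := fun x => by
      have h3 := EuclideanSpace.inner_single_right i (1 : ℝ) (∇ f x)
      rw [inner_gradient_left] at h3
      simp only [add_apply, smul_apply, h3]
      simp
      ring
    have := integral_fderiv_apply_eq_zero (EuclideanSpace.single i 1) hd ?_ ?_
    · rw [← this]
      exact integral_congr_ae (ae_of_all _ fun x => (heq x).symm)
    · refine (h0.add h1).mono' (by fun_prop) (ae_of_all _ fun x => ?_)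
      rw [norm_mul, Real.norm_eq_abs, Real.norm_of_nonneg (sq_nonneg _)]
      have := abs_coord_le_norm x i
      simp only [Pi.add_apply]
      nlinarith [sq_nonneg (f x), sq_nonneg (‖x‖ - 1), mul_le_mul_of_nonneg_right this
        (sq_nonneg (f x)), mul_nonneg (sq_nonneg (f x)) (sq_nonneg (‖x‖ - 1)),
        mul_nonneg (sq_nonneg (f x)) (norm_nonneg x)]
    · exact (hI i).congr (ae_of_all _ fun x => (heq x).symm)
  have hsum : ∫ x, ∑ i : Fin N, (f x ^ 2 + 2 * (f x * (x i * (∇ f x) i))) = 0 := by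
    rw [integral_finsetSum _ fun i _ => hI i]
    exact Finset.sum_eq_zero fun i _ => key i
  have hpt : ∀ x, ∑ i : Fin N, (f x ^ 2 + 2 * (f x * (x i * (∇ f x) i))) =
      N * f x ^ 2 + 2 * (f x * inner ℝ (∇ f x) x) := fun x => by
    rw [PiLp.inner_apply, Finset.sum_add_distrib, ← Finset.mul_sum, ← Finset.mul_sum]
    simp
  simp only [hpt] at hsum
  rw [integral_add (h0.const_mul _) ((integrable_mul_inner_gradient hf h1 h2).const_mul 2),
    integral_const_mul, integral_const_mul] at hsum
  linarith

/-- A function with zero mean on all spheres is orthogonal to all radial functions. -/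
theorem integral_mul_radial_eq_zero {N : ℕ} (hN : 1 ≤ N) {f : RN N → ℝ}
    (hf : ∀ r : ℝ, 0 < r → sphereIntegral (fun σ => f (r • σ)) = 0) (φ : ℝ → ℝ) :
    ∫ x, f x * φ ‖x‖ = 0 := by
  have : Nonempty (Fin N) := ⟨⟨0, hN⟩⟩
  -- For a non-integrable product the Bochner integral is `0` by convention, so `φ` can be
  -- arbitrary.
  by_cases hi : Integrable fun x => f x * φ ‖x‖
  swap
  · exact integral_undef hi
  have mp := (volume : Measure (RN N)).measurePreserving_homeomorphUnitSphereProd.symm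
    (homeomorphUnitSphereProd (RN N)).toMeasurableEquiv
  have me : MeasurableEmbedding (homeomorphUnitSphereProd (RN N)).toMeasurableEquiv.symm :=
    MeasurableEquiv.measurableEmbedding _
  set F : RN N → ℝ := fun x => f x * φ ‖x‖ with hF
  have hval : ∀ z, ((homeomorphUnitSphereProd (RN N)).toMeasurableEquiv.symm z : RN N) =
      (z.2 : ℝ) • (z.1 : RN N) := fun z => homeomorphUnitSphereProd_symm_apply_coe _ z
  have hi' : Integrable (fun z : Metric.sphere (0 : RN N) 1 × Set.Ioi (0 : ℝ) =>
      F ((z.2 : ℝ) • (z.1 : RN N)))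
      ((volume : Measure (RN N)).toSphere.prod
        (Measure.volumeIoiPow (finrank ℝ (RN N) - 1))) := by
    simp only [← hval]
    refine (mp.integrable_comp_emb me (g := fun x => F x)).2 ?_
    rw [← restrict_compl_singleton (μ := (volume : Measure (RN N))) 0, ← IntegrableOn,
      integrableOn_iff_comap_subtypeVal (by measurability)] at hi
    exact hi
  have e1 : ∫ x, F x = ∫ z : Metric.sphere (0 : RN N) 1 × Set.Ioi (0 : ℝ),
      F ((z.2 : ℝ) • (z.1 : RN N)) ∂((volume : Measure (RN N)).toSphere.prod
        (Measure.volumeIoiPow (finrank ℝ (RN N) - 1))) := by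
    simp only [← hval]
    rw [mp.integral_comp me (fun x => F x),
      integral_subtype_comap (measurableSet_singleton _).compl, restrict_compl_singleton]
  rw [e1, integral_prod_symm _ hi']
  -- In polar coordinates `φ` is constant on each sphere and factors out of the inner integral.
  refine integral_eq_zero_of_ae (ae_of_all _ fun r => ?_)
  have hr : (0 : ℝ) < r := r.2
  have hn : ∀ σ : Metric.sphere (0 : RN N) 1, F ((r : ℝ) • (σ : RN N)) =
      f ((r : ℝ) • (σ : RN N)) * φ r := fun σ => by
    simp [hF, norm_smul, abs_of_pos hr]
  simp only [hn]
  rw [integral_mul_const]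
  have := hf r hr
  rw [sphereIntegral] at this
  rw [this, zero_mul, Pi.zero_apply]

theorem normD_lt_top_iff {N : ℕ} {f : RN N → ℝ} (hf : ContDiff ℝ 1 f) :
    normD f < ⊤ ↔ Integrable (fun x => f x ^ 2) ∧ Integrable (fun x => f x ^ 2 * ‖x‖ ^ 2) ∧
      Integrable fun x => ‖∇ f x‖ ^ 2 := by
  have hg := continuous_gradient hf
  have hc := hf.continuous
  have conv : ∀ k : RN N → ℝ, Continuous k → (Integrable k ↔ ∫⁻ x, ‖k x‖ₑ < ⊤) := fun k hk =>
    ⟨fun h => h.2, fun h => ⟨hk.aestronglyMeasurable, h⟩⟩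
  rw [conv _ (by fun_prop), conv _ (by fun_prop), conv _ (by fun_prop), normD,
    ENNReal.rpow_lt_top_iff_of_pos (by norm_num), ENNReal.add_lt_top, ENNReal.add_lt_top,
    and_assoc]
  simp only [enorm_mul, enorm_pow, enorm_norm]

/-- The parameter `a` of the Gaussian is free, so a family of linear inequalities between the three
integrals is traded for one discriminant. -/
theorem uncertainty_of_zero_mean {N : ℕ} (hN : 1 ≤ N) {f : RN N → ℝ} (hf : ContDiff ℝ 1 f)
    (hD : normD f < ⊤)
    (hz : ∀ r : ℝ, 0 < r → sphereIntegral (fun σ => f (r • σ)) = 0) :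
    (((N : ℝ) + 2) / 2) ^ 2 * (∫ x, f x ^ 2) ^ 2 ≤
      (∫ x, ‖∇ f x‖ ^ 2) * ∫ x, f x ^ 2 * ‖x‖ ^ 2 := by
  obtain ⟨h0, h1, h2⟩ := (normD_lt_top_iff hf).1 hD
  have h3 := integrable_mul_inner_gradient hf h1 h2
  have ibp := two_mul_integral_mul_inner_gradient hf h0 h1 h2
  have hC : 0 ≤ ∫ x, f x ^ 2 := integral_nonneg fun x => by positivity
  have hA : 0 ≤ ∫ x, ‖∇ f x‖ ^ 2 := integral_nonneg fun x => by positivity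
  have hB : 0 ≤ ∫ x, f x ^ 2 * ‖x‖ ^ 2 := integral_nonneg fun x => by positivity
  set A := ∫ x, ‖∇ f x‖ ^ 2
  set B := ∫ x, f x ^ 2 * ‖x‖ ^ 2
  set C := ∫ x, f x ^ 2
  have quad : ∀ a : ℝ, 0 ≤ B * (a * a) + (-((N + 2) * C)) * a + A := fun a => by
    -- The discriminant criterion needs all real `a`; for `a ≤ 0` every term is nonnegative.
    rcases le_or_gt a 0 with ha | ha
    · have : 0 ≤ ((N : ℝ) + 2) * C * -a := by
        have : 0 ≤ -a := by linarith
        positivity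
      nlinarith [mul_nonneg hB (mul_self_nonneg a)]
    have hp := lintegral_sq_le_of_integral_mul_exp_eq_zero ha hf h0
      (integral_mul_radial_eq_zero hN hz fun r => Real.exp (-(a / 2) * r ^ 2))
    have hpt : ∀ x, ‖∇ f x + (a * f x) • x‖ ^ 2 =
        ‖∇ f x‖ ^ 2 + 2 * a * (f x * inner ℝ (∇ f x) x) + a ^ 2 * (f x ^ 2 * ‖x‖ ^ 2) := fun x => by
      rw [norm_add_sq_real, inner_smul_right, norm_smul, mul_pow, Real.norm_eq_abs, sq_abs]
      ring
    have hI : Integrable fun x => ‖∇ f x + (a * f x) • x‖ ^ 2 := by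
      simp only [hpt]
      exact (h2.add (h3.const_mul _)).add (h1.const_mul _)
    have c1 : ∫⁻ x, ‖f x‖ₑ ^ 2 = ENNReal.ofReal C := by
      rw [ofReal_integral_eq_lintegral_ofReal h0 (ae_of_all _ fun _ => sq_nonneg _)]
      simp [← enorm_pow, Real.enorm_of_nonneg, sq_nonneg]
    have c2 : ∫⁻ x, ‖∇ f x + (a * f x) • x‖ₑ ^ 2 =
        ENNReal.ofReal (∫ x, ‖∇ f x + (a * f x) • x‖ ^ 2) := by
      rw [ofReal_integral_eq_lintegral_ofReal hI (ae_of_all _ fun _ => sq_nonneg _)]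
      simp [ENNReal.ofReal_pow]
    have c3 : ∫ x, ‖∇ f x + (a * f x) • x‖ ^ 2 = A - a * N * C + a ^ 2 * B := by
      simp only [hpt]
      rw [integral_add (by exact h2.add (h3.const_mul _)) (h1.const_mul _),
        integral_add h2 (h3.const_mul _), integral_const_mul, integral_const_mul]
      linear_combination a * ibp
    rw [c1, c2, ← ENNReal.ofReal_mul (by positivity),
      ENNReal.ofReal_le_ofReal_iff (integral_nonneg fun x => by positivity), c3] at hp
    linarith
  have := discrim_le_zero quad
  rw [discrim] at this
  linarith

end Uncertainty

/-! ### The extremal profiles: admissibility and equality -/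

section GaussProfile

open scoped Topology

/-- Half of the exponent absorbs the polynomial, by `t^k / k! ≤ exp t` at `t = c|x|²/2`. -/
theorem integrable_norm_sq_pow_mul_exp {N : ℕ} {c : ℝ} (hc : 0 < c) (k : ℕ) :
    Integrable fun x : RN N => (‖x‖ ^ 2) ^ k * Real.exp (-c * ‖x‖ ^ 2) := by
  have h0 : Integrable fun x : RN N => Real.exp (-(c / 2) * ‖x‖ ^ 2) := by
    -- A non-integrable function has integral `0`, whereas the explicit Gaussian integral is
    -- positive.
    refine .of_integral_ne_zero ?_
    rw [GaussianFourier.integral_rexp_neg_mul_sq_norm (by positivity)]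
    positivity
  refine (h0.const_mul (k.factorial * (2 / c) ^ k)).mono' (by fun_prop) (ae_of_all _ fun x => ?_)
  rw [Real.norm_of_nonneg (by positivity)]
  have h1 := Real.pow_div_factorial_le_exp (c / 2 * ‖x‖ ^ 2) (by positivity) k
  rw [div_le_iff₀ (by positivity), mul_pow] at h1
  have h2 : (‖x‖ ^ 2) ^ k ≤ k.factorial * (2 / c) ^ k * Real.exp (c / 2 * ‖x‖ ^ 2) := by
    calc (‖x‖ ^ 2) ^ k = (2 / c) ^ k * ((c / 2) ^ k * (‖x‖ ^ 2) ^ k) := by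
          rw [← mul_assoc, ← mul_pow, show 2 / c * (c / 2) = 1 by field_simp, one_pow, one_mul]
      _ ≤ (2 / c) ^ k * (Real.exp (c / 2 * ‖x‖ ^ 2) * k.factorial) := by gcongr
      _ = _ := by ring
  calc _ ≤ k.factorial * (2 / c) ^ k * Real.exp (c / 2 * ‖x‖ ^ 2) * Real.exp (-c * ‖x‖ ^ 2) := by
        gcongr
    _ = _ := by
        rw [mul_assoc, ← Real.exp_add]
        ring_nf

theorem gaussProfile_eq_inner {N : ℕ} (B₀ : ℝ) (B : Fin N → ℝ) :
    gaussProfile B₀ B =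
      fun x => inner ℝ (WithLp.toLp 2 B) x * Real.exp (-B₀ * ‖x‖ ^ 2) := by
  ext x
  rw [gaussProfile, PiLp.inner_apply]
  simp [mul_comm (B _)]

theorem contDiff_inner_mul_exp {N : ℕ} (b : RN N) (a : ℝ) {n : WithTop ℕ∞} :
    ContDiff ℝ n fun x : RN N => inner ℝ b x * Real.exp (a * ‖x‖ ^ 2) :=
  (contDiff_const.inner ℝ contDiff_id).mul (contDiff_const.mul (contDiff_norm_sq ℝ)).exp

theorem gradient_inner_mul_exp {N : ℕ} (b : RN N) (a : ℝ) (x : RN N) :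
    ∇ (fun y : RN N => inner ℝ b y * Real.exp (a * ‖y‖ ^ 2)) x =
      Real.exp (a * ‖x‖ ^ 2) • (b + (2 * a * inner ℝ b x) • x) := by
  have h : HasGradientAt (fun y : RN N => inner ℝ b y) b x :=
    hasGradientAt_iff_hasFDerivAt.2 (InnerProductSpace.toDual ℝ (RN N) b).hasFDerivAt
  exact (h.mul_exp_norm_sq a).gradient

theorem inner_sq_le {N : ℕ} (b x : RN N) : inner ℝ b x ^ 2 ≤ ‖b‖ ^ 2 * ‖x‖ ^ 2 := by
  rw [← mul_pow, ← sq_abs]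
  gcongr
  exact abs_real_inner_le_norm b x

theorem integrable_inner_sq_mul_norm_mul_exp {N : ℕ} (b : RN N) {c : ℝ} (hc : 0 < c) (k : ℕ) :
    Integrable fun x : RN N => inner ℝ b x ^ 2 * (‖x‖ ^ 2) ^ k * Real.exp (-c * ‖x‖ ^ 2) := by
  refine ((integrable_norm_sq_pow_mul_exp hc (k + 1)).const_mul (‖b‖ ^ 2)).mono' (by fun_prop)
    (ae_of_all _ fun x => ?_)
  rw [Real.norm_of_nonneg (by positivity)]
  calc _ ≤ ‖b‖ ^ 2 * ‖x‖ ^ 2 * (‖x‖ ^ 2) ^ k * Real.exp (-c * ‖x‖ ^ 2) := by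
        gcongr; exact inner_sq_le b x
    _ = _ := by ring

/-- Second moments of the Gaussian weight. -/
theorem norm_sq_mul_integral_exp {N : ℕ} (b : RN N) {c : ℝ} (hc : 0 < c) :
    ‖b‖ ^ 2 * ∫ x : RN N, Real.exp (-c * ‖x‖ ^ 2) =
      2 * c * ∫ x : RN N, inner ℝ b x ^ 2 * Real.exp (-c * ‖x‖ ^ 2) := by
  have i0 : Integrable fun x : RN N => Real.exp (-c * ‖x‖ ^ 2) := by
    simpa using integrable_norm_sq_pow_mul_exp (N := N) hc 0
  have i1 : Integrable fun x : RN N => inner ℝ b x ^ 2 * Real.exp (-c * ‖x‖ ^ 2) := by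
    simpa using integrable_inner_sq_mul_norm_mul_exp b hc 0
  set h : RN N → ℝ := fun x => inner ℝ b x * Real.exp (-c * ‖x‖ ^ 2) with hh
  have hd : ∀ x, HasFDerivAt h (fderiv ℝ h x) x := fun x =>
    ((contDiff_inner_mul_exp b (-c) (n := 1)).differentiable one_ne_zero x).hasFDerivAt
  have hb : ∀ x, fderiv ℝ h x b = ‖b‖ ^ 2 * Real.exp (-c * ‖x‖ ^ 2) -
      2 * c * (inner ℝ b x ^ 2 * Real.exp (-c * ‖x‖ ^ 2)) := fun x => by
    rw [← inner_gradient_left, hh, gradient_inner_mul_exp, real_inner_smul_left, inner_add_left,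
      real_inner_smul_left, real_inner_self_eq_norm_sq, real_inner_comm b x]
    ring
  -- The derivative of `⟨b, x⟩ exp(-c|x|²)` in the direction `b` contains both moments.
  have key := integral_fderiv_apply_eq_zero b hd ?_ ?_
  · simp only [hb] at key
    rw [integral_sub (i0.const_mul _) (i1.const_mul _), integral_const_mul,
      integral_const_mul] at key
    linarith
  · refine (i0.add i1).mono' (by fun_prop) (ae_of_all _ fun x => ?_)
    simp only [hh, Pi.add_apply]
    rw [norm_mul, Real.norm_of_nonneg (Real.exp_nonneg _), ← one_add_mul, Real.norm_eq_abs]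
    gcongr
    rw [← sq_abs]
    nlinarith [sq_nonneg (|inner ℝ b x| - 1), abs_nonneg (inner ℝ b x)]
  · simp only [hb]
    exact (i0.const_mul _).sub (i1.const_mul _)

/-- The surface measure of a set is defined through the volume of the cone over it, and volume is
invariant under negation. -/
theorem measurePreserving_neg_sphere (N : ℕ) : MeasurePreserving
    (fun σ : Metric.sphere (0 : RN N) 1 => -σ) (volume : Measure (RN N)).toSphere
    (volume : Measure (RN N)).toSphere := by
  have hm : Measurable fun σ : Metric.sphere (0 : RN N) 1 => -σ := continuous_neg.measurable
  refine ⟨hm, ?_⟩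
  ext s hs
  rw [Measure.map_apply hm hs, Measure.toSphere_apply' _ (hm hs), Measure.toSphere_apply' _ hs]
  congr 1
  rw [← Measure.measure_neg]
  congr 1
  ext x
  simp only [Set.mem_neg, Set.mem_smul, Set.mem_image, Set.mem_preimage]
  constructor
  · rintro ⟨t, ht, _, ⟨σ, hσ, rfl⟩, hx⟩
    exact ⟨t, ht, _, ⟨-σ, hσ, rfl⟩, by simp [hx]⟩
  · rintro ⟨t, ht, _, ⟨σ, hσ, rfl⟩, hx⟩
    exact ⟨t, ht, _, ⟨-σ, by simpa using hσ, rfl⟩, by simp [hx]⟩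

theorem sphereIntegral_eq_zero_of_odd {N : ℕ} {g : RN N → ℝ} (hg : ∀ x, g (-x) = -g x) :
    sphereIntegral g = 0 := by
  have h := (measurePreserving_neg_sphere N).integral_comp
    (Homeomorph.neg (Metric.sphere (0 : RN N) 1)).measurableEmbedding fun σ => g σ
  simp only [coe_neg_sphere, hg, integral_neg] at h
  rw [sphereIntegral]
  linarith

/-- By homogeneity the spherical integral is a constant times `R² exp(-2aR²)`, which beats every
power of `R`. -/
theorem gaussProfile_decay {N : ℕ} {a : ℝ} (ha : 0 < a) (b : RN N) :
    (fun R : ℝ => sphereIntegral fun σ =>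
      (inner ℝ b (R • σ) * Real.exp (-a * ‖R • σ‖ ^ 2)) ^ 2) =o[atTop]
        fun R : ℝ => R ^ (-(N : ℤ)) := by
  have heq : ∀ R : ℝ, (sphereIntegral fun σ =>
      (inner ℝ b (R • σ) * Real.exp (-a * ‖R • σ‖ ^ 2)) ^ 2) =
      R ^ 2 * Real.exp (-(2 * a) * R ^ 2) * sphereIntegral fun σ : RN N => inner ℝ b σ ^ 2 := by
    intro R
    rw [sphereIntegral, sphereIntegral, ← integral_const_mul]
    refine integral_congr_ae (ae_of_all _ fun σ => ?_)
    have hσ : ‖(σ : RN N)‖ = 1 := by simp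
    simp only [norm_smul, hσ, real_inner_smul_right, mul_one, Real.norm_eq_abs, sq_abs, mul_pow,
      ← Real.exp_nat_mul]
    rw [show ((2 : ℕ) : ℝ) * (-a * R ^ 2) = -(2 * a) * R ^ 2 by push_cast; ring]
    ring
  simp only [heq]
  have hlim : Tendsto (fun R : ℝ => R ^ (N + 2) * Real.exp (-(2 * a) * R ^ 2)) atTop (𝓝 0) := by
    have h1 := rpow_mul_exp_neg_mul_sq_isLittleO_exp_neg (b := 2 * a) (by positivity)
      ((N + 2 : ℕ) : ℝ)
    have h2 : Tendsto (fun x : ℝ => Real.exp (-(1 / 2) * x)) atTop (𝓝 0) :=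
      Real.tendsto_exp_atBot.comp (tendsto_id.const_mul_atTop_of_neg (by norm_num))
    simpa only [Real.rpow_natCast] using h1.trans_tendsto h2
  refine (isLittleO_iff_tendsto' ?_).2 ?_
  · filter_upwards [eventually_gt_atTop 0] with R hR h
    exact absurd h (zpow_ne_zero _ hR.ne')
  · have := hlim.mul_const (sphereIntegral fun σ : RN N => inner ℝ b σ ^ 2)
    rw [zero_mul] at this
    refine this.congr' ?_
    filter_upwards [eventually_gt_atTop 0] with R hR
    rw [zpow_neg, zpow_natCast, div_inv_eq_mul]
    ring

/-- Zero mean holds by oddness. For equality, the Euler identity gives `2B₀ B = (N+2)/2 · C` and the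
second moment identity gives `A = 4B₀² B`, where `A`, `B`, `C` are the integrals of `|∇f|²`,
`f²|x|²`, `f²`. Thus `AB = (2B₀ B)²`. -/
theorem isTestField_and_equality_gaussProfile {N : ℕ} {B₀ : ℝ} (hB : 0 < B₀) (B : Fin N → ℝ) :
    IsTestField (gaussProfile B₀ B) ∧
      (∫ x, ‖∇ (gaussProfile B₀ B) x‖ ^ 2) * (∫ x, gaussProfile B₀ B x ^ 2 * ‖x‖ ^ 2) =
        (((N : ℝ) + 2) / 2) ^ 2 * (∫ x, gaussProfile B₀ B x ^ 2) ^ 2 := by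
  rw [gaussProfile_eq_inner]
  set b : RN N := WithLp.toLp 2 B
  set f : RN N → ℝ := fun x => inner ℝ b x * Real.exp (-B₀ * ‖x‖ ^ 2) with hf
  have hc : 0 < 2 * B₀ := by positivity
  have hE : ∀ x : RN N, Real.exp (-B₀ * ‖x‖ ^ 2) ^ 2 = Real.exp (-(2 * B₀) * ‖x‖ ^ 2) := fun x => by
    rw [← Real.exp_nat_mul]; congr 1; push_cast; ring
  have hsq : ∀ x, f x ^ 2 = inner ℝ b x ^ 2 * Real.exp (-(2 * B₀) * ‖x‖ ^ 2) := fun x => by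
    rw [hf, mul_pow, hE]
  have hgrad : ∀ x, ∇ f x = Real.exp (-B₀ * ‖x‖ ^ 2) • (b + (2 * -B₀ * inner ℝ b x) • x) :=
    gradient_inner_mul_exp b (-B₀)
  have hgsq : ∀ x, ‖∇ f x‖ ^ 2 = ‖b‖ ^ 2 * Real.exp (-(2 * B₀) * ‖x‖ ^ 2) -
      4 * B₀ * f x ^ 2 + 4 * B₀ ^ 2 * (f x ^ 2 * ‖x‖ ^ 2) := fun x => by
    rw [hgrad, norm_smul, mul_pow, Real.norm_eq_abs, sq_abs, hE, norm_add_sq_real,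
      inner_smul_right, norm_smul, mul_pow, Real.norm_eq_abs, sq_abs, hsq]
    ring
  have hinn : ∀ x, f x * inner ℝ (∇ f x) x = f x ^ 2 - 2 * B₀ * (f x ^ 2 * ‖x‖ ^ 2) := fun x => by
    rw [hgrad, real_inner_smul_left, inner_add_left, real_inner_smul_left,
      real_inner_self_eq_norm_sq]
    simp only [hf]
    ring
  have iE : Integrable fun x : RN N => Real.exp (-(2 * B₀) * ‖x‖ ^ 2) := by
    simpa using integrable_norm_sq_pow_mul_exp (N := N) hc 0
  have i0 : Integrable fun x => f x ^ 2 := by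
    simp only [hsq]
    simpa using integrable_inner_sq_mul_norm_mul_exp b hc 0
  have i1 : Integrable fun x => f x ^ 2 * ‖x‖ ^ 2 := by
    refine (integrable_inner_sq_mul_norm_mul_exp b hc 1).congr (ae_of_all _ fun x => ?_)
    simp only [hsq]
    ring
  have i2 : Integrable fun x => ‖∇ f x‖ ^ 2 := by
    simp only [hgsq]
    exact ((iE.const_mul _).sub (i0.const_mul _)).add (i1.const_mul _)
  have hf1 : ContDiff ℝ 1 f := contDiff_inner_mul_exp b (-B₀)
  refine ⟨⟨contDiff_inner_mul_exp b (-B₀), (normD_lt_top_iff hf1).2 ⟨i0, i1, i2⟩, fun r _ => ?_,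
    gaussProfile_decay hB b⟩, ?_⟩
  · exact sphereIntegral_eq_zero_of_odd fun x => by simp [hf]
  · have e1 := two_mul_integral_mul_inner_gradient hf1 i0 i1 i2
    simp only [hinn] at e1
    rw [integral_sub i0 (i1.const_mul _), integral_const_mul] at e1
    have e2 := norm_sq_mul_integral_exp b hc
    simp only [← hsq] at e2
    have e3 : ∫ x, ‖∇ f x‖ ^ 2 = 4 * B₀ ^ 2 * ∫ x, f x ^ 2 * ‖x‖ ^ 2 := by
      simp only [hgsq]
      rw [integral_add (by exact (iE.const_mul _).sub (i0.const_mul _)) (i1.const_mul _),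
        integral_sub (iE.const_mul _) (i0.const_mul _), integral_const_mul, integral_const_mul,
        integral_const_mul, e2]
      ring
    rw [e3]
    have e4 : 2 * B₀ * ∫ x, f x ^ 2 * ‖x‖ ^ 2 = ((N : ℝ) + 2) / 2 * ∫ x, f x ^ 2 := by linarith
    -- Difference of squares: the multiplier of `e4` is the sum of its two sides.
    linear_combination (2 * B₀ * (∫ x, f x ^ 2 * ‖x‖ ^ 2) +
      ((N : ℝ) + 2) / 2 * ∫ x, f x ^ 2) * e4

end GaussProfile

theorem lemma3p1 (N : ℕ) (hN : 1 ≤ N) :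
    (∀ f : RN N → ℝ, IsTestField f →
      (((N : ℝ) + 2) / 2) ^ 2 * (∫ x, f x ^ 2) ^ 2 ≤
        (∫ x, ‖∇ f x‖ ^ 2) * ∫ x, f x ^ 2 * ‖x‖ ^ 2) ∧
    (∀ (B₀ : ℝ) (B : Fin N → ℝ), 0 < B₀ →
      IsTestField (gaussProfile B₀ B) ∧
      (∫ x, ‖∇ (gaussProfile B₀ B) x‖ ^ 2) * (∫ x, gaussProfile B₀ B x ^ 2 * ‖x‖ ^ 2) =
        (((N : ℝ) + 2) / 2) ^ 2 * (∫ x, gaussProfile B₀ B x ^ 2) ^ 2) := by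
  exact ⟨fun _ hf => uncertainty_of_zero_mean hN (hf.smooth.of_le (by norm_cast))
      hf.normD_lt_top hf.zero_mean,
    fun _ B hB => isTestField_and_equality_gaussProfile hB B⟩
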